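/- Let $m\ge 2$, $A=\mathbb Z/2\mathbb Z$, $B=(\mathbb Z/2\mathbb Z)^m$, let $\mathrm{Epi}(B,A)$ be the set of surjective homomorphisms $B\to A$, and let $\Xi_{2,m}$ be the set of sequences $\xi=(\xi_r)_{r\ge 0}$ in $\mathrm{Epi}(B,A)$ with $\bigcap_{j\ge k}\ker\xi_j=\{0\}$ for every $k\ge 0$. Let $T_2$ be the infinite binary rooted tree, whose vertices are the finite words over $\mathbb Z/2\mathbb Z$ and whose boundary consists of the infinite words. Let $a\in\mathrm{Aut}(T_2)$ exchange the two branches at the root, $a(xw)=(x+1)w$. For $b\in B$ let $b_\xi\in\mathrm{Aut}(T_2)$ be given by $b_\xi(1^r0yw)=1^r0(y+\xi_r(b))w$ for all $r\ge 0$, all letters $y$ and all words $w$, with all vertices $1^r$ and $1^r0$ fixed. The spinal group $G_\xi$ is generated by $S_\xi=\{a\}\cup(\{b_\xi : b\in B\}\setminus\{\mathrm{id}\})$; it acts on the boundary of $T_2$. The Schreier graph of the orbit of $1^\infty$ has the points of the orbit as its vertices and, for every vertex $x$ and every $s\in S_\xi$, an edge from $x$ to $s\cdot x$ labelled by $s$.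 Let $\mathcal A=\{a\}\cup\{\alpha_\phi : \phi\in\mathrm{Epi}(B,A)\}$, where the letter $a$ stands for the set of labels $\{a\}$ and $\alpha_\phi$ for the set of labels $\{b_\xi : b\in B\setminus\ker\phi\}$. For a one-sided or two-sided infinite word $w$ let $\mathcal W(w)$ be the set of finite words occurring in $w$. Given letters $(a_k)_{k\ge 0}$ and integers $n_k\ge 2$ $(k\ge 0)$ such that $a_{k+1}\ne a_k$ for all $k$ and such that the eventual alphabet (the set of letters that occur infinitely often in $(a_k)$) has at least two elements, put $p^{(-1)}=\epsilon$ (the empty word), and let $p^{(k)}=p^{(k-1)}a_kp^{(k-1)}\cdots a_kp^{(k-1)}$ with $n_k$ blocks $p^{(k-1)}$ and $n_k-1$ letters $a_k$. With $p^{(\infty)}=\lim_k p^{(k)}$, the set $\{\omega\in\mathcal A^{\mathbb Z} : \mathcal W(\omega)\subseteq\mathcal W(p^{(\infty)})\}$ is called a simple Toeplitz subshift. Theorem. Let $m\ge 2$ and $\xi\in\Xi_{2,m}$. Up to loops and multiplicities of edges, the Schreier graph of the orbit of $1^\infty$ is a one-sided infinite line $v_0=1^\infty,v_1,v_2,\dots$,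 and there is exactly one word $\eta=\eta_0\eta_1\eta_2\cdots$ over $\mathcal A$ such that, for every $i\ge 0$, $\eta_i$ stands for the set of labels of the edges from $v_i$ to $v_{i+1}$. The associated set $$\Omega_\xi=\{\omega\in\mathcal A^{\mathbb Z} : \mathcal W(\omega)\subseteq\mathcal W(\eta)\}$$ is a non-empty subshift, that is, it is closed and invariant under the shift. It is a simple Toeplitz subshift with eventual alphabet $\{\alpha_\phi : \xi_j=\phi\text{ for infinitely many }j\}$. This eventual alphabet has at least two letters, and $\Omega_\xi$ is aperiodic: no element of $\Omega_\xi$ is periodic. -/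

import Mathlib

/-! ### Words and subshifts -/

section Words

variable {A : Type*}

/-- The set `𝒲(p)` of finite words occurring in the one-sided infinite word `p`. -/
def wordsOf (p : ℕ → A) : Set (List A) :=
  {w | ∃ k : ℕ, w = List.ofFn fun i : Fin w.length => p (k + i)}

/-- The set `𝒲(ω)` of finite words occurring in the two-sided infinite word `ω`. -/
def biWordsOf (ω : ℤ → A) : Set (List A) :=
  {w | ∃ k : ℤ, w = List.ofFn fun i : Fin w.length => ω (k + (i : ℕ))}

/-- The two-sided subshift associated with a one-sided infinite word `p`:
all two-sided words whose finite subwords all occur in `p`. -/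
def wordSubshift (p : ℕ → A) : Set (ℤ → A) :=
  {ω | biWordsOf ω ⊆ wordsOf p}

/-- The shift `(T s)(n) = s(n + 1)`. -/
def shiftMap (s : ℤ → A) : ℤ → A := fun n => s (n + 1)

/-- A subshift: a set of two-sided words that is closed in the product topology
(the alphabet being discrete) and invariant under the shift. -/
def IsSubshift (Ω : Set (ℤ → A)) : Prop :=
  letI : TopologicalSpace A := ⊥
  IsClosed Ω ∧ shiftMap '' Ω = Ω

/-- No element of `Ω` is periodic. -/
def IsAperiodic (Ω : Set (ℤ → A)) : Prop :=
  ∀ ω ∈ Ω, ∀ q : ℕ, 0 < q → shiftMap^[q] ω ≠ ω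

/-! ### Simple Toeplitz subshifts -/

/-- The letters that appear infinitely often in the sequence `a`. -/
def eventualAlphabet (a : ℕ → A) : Set A :=
  {x | ∃ᶠ k in Filter.atTop, a k = x}

/-- Coding sequences of a simple Toeplitz subshift. -/
structure IsToeplitzCoding (a : ℕ → A) (n : ℕ → ℕ) : Prop where
  two_le : ∀ k, 2 ≤ n k
  succ_ne : ∀ k, a (k + 1) ≠ a k
  two_le_card : 2 ≤ (eventualAlphabet a).encard

/-- The palindromic blocks. The index is shifted by one, so that `toeplitzBlock a n 0` is the
empty block `p⁽⁻¹⁾` and `toeplitzBlock a n (k + 1)` is `p⁽ᵏ⁾`, which consists of `n k` copies of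
the preceding block separated by `n k - 1` letters `a k`. -/
def toeplitzBlock (a : ℕ → A) (n : ℕ → ℕ) : ℕ → List A
  | 0 => []
  | k + 1 =>
      (List.replicate (n k - 1) (toeplitzBlock a n k ++ [a k])).flatten ++ toeplitzBlock a n k

/-- The limit `p⁽∞⁾` of the blocks. Each block is a prefix of the next one, and, when all `n k`
are at least two, the block `toeplitzBlock a n (i + 1)` has length at least `2 ^ (i + 1) - 1 > i`,
so that the default value `a 0` is not used. -/
def toeplitzWord (a : ℕ → A) (n : ℕ → ℕ) : ℕ → A :=
  fun i => (toeplitzBlock a n (i + 1)).getD i (a 0)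

/-- `Ω` is a simple Toeplitz subshift with eventual alphabet `E`. -/
def IsSimpleToeplitz (Ω : Set (ℤ → A)) (E : Set A) : Prop :=
  ∃ (a : ℕ → A) (n : ℕ → ℕ), IsToeplitzCoding a n ∧ eventualAlphabet a = E ∧
    Ω = wordSubshift (toeplitzWord a n)

end Words

/-! ### The binary rooted tree, its automorphisms and its boundary -/

/-- The vertices of the infinite binary rooted tree: finite words over `ℤ/2ℤ`, with the
root `[]`; the descendants of a vertex are its extensions. -/
abbrev TreeVertex : Type := List (ZMod 2)

/-- The automorphism group of the binary rooted tree: the permutations of the vertices that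
preserve the level and the relation of being an ancestor. -/
def treeAut : Subgroup (Equiv.Perm TreeVertex) where
  carrier := {g | (∀ u, (g u).length = u.length) ∧ ∀ u v, g u <+: g v ↔ u <+: v}
  mul_mem' := by
    rintro g h ⟨hg1, hg2⟩ ⟨hh1, hh2⟩
    exact ⟨fun u => by simp [hg1, hh1], fun u v => by simp [hg2, hh2]⟩
  one_mem' := ⟨fun _ => rfl, fun _ _ => Iff.rfl⟩
  inv_mem' := by
    rintro g ⟨hg1, hg2⟩
    refine ⟨fun u => ?_, fun u v => ?_⟩
    · rw [← hg1]; simp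
    · rw [← hg2]; simp

/-- The boundary of the binary rooted tree: infinite words over `ℤ/2ℤ`. -/
abbrev TreeBoundary : Type := ℕ → ZMod 2

/-- The vertex at level `n` on the ray from the root to the boundary point `x`. -/
def rayVertex (x : TreeBoundary) (n : ℕ) : TreeVertex := List.ofFn fun i : Fin n => x i

theorem rayVertex_length (x : TreeBoundary) (n : ℕ) : (rayVertex x n).length = n := by
  simp [rayVertex]

theorem rayVertex_prefix (x : TreeBoundary) {k n : ℕ} (h : k ≤ n) :
    rayVertex x k <+: rayVertex x n := by
  have : rayVertex x k = (rayVertex x n).take k := by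
    apply List.ext_getElem
    · simp [rayVertex, h]
    · intro i h1 h2
      simp [rayVertex]
  rw [this]
  exact List.take_prefix _ _

/-- The image of a boundary point under a tree automorphism: its `n`-th letter is the last letter
of the image of the `(n + 1)`-st vertex on the ray to `x`. -/
def boundaryMap (g : treeAut) (x : TreeBoundary) : TreeBoundary :=
  fun n => (g.1 (rayVertex x (n + 1))).getD n 0

/-- The ray to the image of `x` is the image of the ray to `x`. -/
theorem rayVertex_boundaryMap (g : treeAut) (x : TreeBoundary) (n : ℕ) :
    rayVertex (boundaryMap g x) n = g.1 (rayVertex x n) := by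
  have hl : ∀ k, (g.1 (rayVertex x k)).length = k := fun k => by
    rw [g.2.1, rayVertex_length]
  apply List.ext_getElem
  · rw [rayVertex_length, hl]
  · intro i h1 h2
    rw [hl] at h2
    have hp : g.1 (rayVertex x (i + 1)) <+: g.1 (rayVertex x n) :=
      (g.2.2 _ _).2 (rayVertex_prefix x h2)
    have h3 : i < (g.1 (rayVertex x (i + 1))).length := by rw [hl]; omega
    have h4 : (rayVertex (boundaryMap g x) n)[i] = boundaryMap g x i := by
      unfold rayVertex
      exact List.getElem_ofFn _
    rw [h4, ← hp.getElem h3]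
    exact List.getD_eq_getElem _ _ h3

theorem rayVertex_injective {x y : TreeBoundary} (h : ∀ n, rayVertex x n = rayVertex y n) :
    x = y := by
  funext n
  have h1 : ∀ i : Fin (n + 1), x i = y i := fun i => congrFun (List.ofFn_inj.1 (h (n + 1))) i
  exact h1 (Fin.last n)

/-- The action of the automorphism group of the tree on the boundary. -/
instance treeBoundaryAction : MulAction treeAut TreeBoundary where
  smul := boundaryMap
  one_smul x := rayVertex_injective fun n => rayVertex_boundaryMap 1 x n
  mul_smul g h x := rayVertex_injective fun n => by
    refine (rayVertex_boundaryMap (g * h) x n).trans ?_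
    refine Eq.trans ?_ (rayVertex_boundaryMap g (boundaryMap h x) n).symm
    rw [rayVertex_boundaryMap]
    rfl

theorem mem_treeAut_of_involutive (f : TreeVertex → TreeVertex) (hf : Function.Involutive f)
    (hl : ∀ u, (f u).length = u.length) (hp : ∀ u v, u <+: v → f u <+: f v) :
    hf.toPerm f ∈ treeAut :=
  ⟨hl, fun u v => ⟨fun h => by simpa [hf u, hf v] using hp _ _ h, hp u v⟩⟩

/-! ### Spinal groups on the binary tree -/

/-- Adds `t` to the first letter: for `t = 1` the two branches at the root are exchanged,
for `t = 0` nothing happens. -/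
def rotateRoot (t : ZMod 2) : TreeVertex → TreeVertex
  | [] => []
  | x :: v => (x + t) :: v

theorem rotateRoot_involutive (t : ZMod 2) : Function.Involutive (rotateRoot t) := by
  rintro (_ | ⟨x, v⟩)
  · rfl
  · simp [rotateRoot, add_assoc, CharTwo.add_self_eq_zero]

theorem rotateRoot_length (t : ZMod 2) (u : TreeVertex) :
    (rotateRoot t u).length = u.length := by
  cases u <;> simp [rotateRoot]

theorem rotateRoot_prefix (t : ZMod 2) (u v : TreeVertex) (h : u <+: v) :
    rotateRoot t u <+: rotateRoot t v := by
  rcases h with ⟨w, rfl⟩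
  cases u <;> simp [rotateRoot]

/-- Applies `rotateRoot (t r)` in the subtree rooted at the vertex `1ʳ0`, for every `r`,
and does nothing else: `1ʳ 0 y w ↦ 1ʳ 0 (y + t r) w`. -/
def spinalFun (t : ℕ → ZMod 2) : TreeVertex → TreeVertex
  | [] => []
  | x :: v => x :: if x = 1 then spinalFun (fun r => t (r + 1)) v else rotateRoot (t 0) v

theorem spinalFun_involutive (t : ℕ → ZMod 2) : Function.Involutive (spinalFun t) := by
  intro u
  induction u generalizing t with
  | nil => rfl
  | cons x v ih =>
    by_cases h : x = 1
    · simp [spinalFun, h, ih]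
    · simp [spinalFun, h, rotateRoot_involutive (t 0) v]

theorem spinalFun_length (t : ℕ → ZMod 2) (u : TreeVertex) :
    (spinalFun t u).length = u.length := by
  induction u generalizing t with
  | nil => rfl
  | cons x v ih =>
    by_cases h : x = 1
    · simp [spinalFun, h, ih]
    · simp [spinalFun, h, rotateRoot_length]

theorem spinalFun_prefix (t : ℕ → ZMod 2) (u v : TreeVertex) (h : u <+: v) :
    spinalFun t u <+: spinalFun t v := by
  induction u generalizing t v with
  | nil => simp [spinalFun]
  | cons x u ih =>
    rcases h with ⟨w, rfl⟩
    by_cases h : x = 1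
    · simpa [spinalFun, h] using ih _ _ (List.prefix_append u w)
    · simpa [spinalFun, h] using rotateRoot_prefix (t 0) _ _ (List.prefix_append u w)

/-- The automorphism `a` that exchanges the two branches at the root. -/
def rootAut : treeAut :=
  ⟨_, mem_treeAut_of_involutive (rotateRoot 1) (rotateRoot_involutive 1) (rotateRoot_length 1)
    (rotateRoot_prefix 1)⟩

/-- `Epi(B, A)` for `B = (ℤ/2ℤ)ᵐ` and `A = ℤ/2ℤ`. -/
abbrev BinaryEpi (m : ℕ) : Type :=
  {φ : (Fin m → ZMod 2) →+ ZMod 2 // Function.Surjective φ}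

/-- `Ξ_{2,m}`: the sequences of epimorphisms whose kernels have trivial intersection over
every tail. -/
def spinalParameters (m : ℕ) : Set (ℕ → BinaryEpi m) :=
  {ξ | ∀ k, ⨅ j, ⨅ _ : k ≤ j, (ξ j).1.ker = ⊥}

/-- The automorphism `b_ξ` given by `b ∈ B`: it rotates by `ξ_r(b)` at the root of the subtree
hanging off the rightmost ray `1^∞` at its `r`-th vertex, that is, at `1ʳ0`. -/
def spinalAut {m : ℕ} (ξ : ℕ → BinaryEpi m) (b : Fin m → ZMod 2) : treeAut :=
  ⟨_, mem_treeAut_of_involutive (spinalFun fun r => (ξ r).1 b) (spinalFun_involutive _)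
    (spinalFun_length _) (spinalFun_prefix _)⟩

/-- The generating set `S_ξ = {a} ∪ B_ξ \ {id}`. -/
def spinalGenerators {m : ℕ} (ξ : ℕ → BinaryEpi m) : Set treeAut :=
  {rootAut} ∪ (Set.range (spinalAut ξ) \ {1})

/-- The spinal group `G_ξ`. -/
def spinalGroup {m : ℕ} (ξ : ℕ → BinaryEpi m) : Subgroup treeAut :=
  Subgroup.closure (spinalGenerators ξ)

/-! ### The subshift associated with a spinal group -/

/-- The labels in `S` of the edges from `x` to `y` in a Schreier graph. -/
def schreierLabels {G X : Type*} [Group G] [MulAction G X] (S : Set G) (x y : X) : Set G :=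
  {s | s ∈ S ∧ s • x = y}

/-- The alphabet `𝒜 = {a} ∪ {α_φ | φ ∈ Epi(B, A)}`. -/
inductive SpinalLetter (m : ℕ) : Type
  | a : SpinalLetter m
  | α (φ : BinaryEpi m) : SpinalLetter m

instance spinalLetterFinite (m : ℕ) : Finite (SpinalLetter m) :=
  have : Finite (BinaryEpi m) :=
    Finite.of_injective (fun φ : BinaryEpi m => (φ.1 : (Fin m → ZMod 2) → ZMod 2))
      fun _ _ h => Subtype.ext (DFunLike.coe_injective h)
  Finite.of_surjective (fun o : Option (BinaryEpi m) => o.elim SpinalLetter.a SpinalLetter.α) (by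
    rintro (_ | φ)
    · exact ⟨none, rfl⟩
    · exact ⟨some φ, rfl⟩)

/-- The set of labels on a multi-edge that a letter stands for: `a` stands for `{a}` and
`α_φ` for `B \ Ker φ`. -/
def letterLabels {m : ℕ} (ξ : ℕ → BinaryEpi m) : SpinalLetter m → Set treeAut
  | .a => {rootAut}
  | .α φ => spinalAut ξ '' {b | φ.1 b ≠ 0}

/-- The rightmost boundary point `1^∞`. -/
def rightmostPoint : TreeBoundary := fun _ => 1

/-- `v` runs once through the vertices of the orbital Schreier graph of `1^∞`, starting at the
root `1^∞`, and the graph is, up to loops and multiplicities of edges, the one-sided infinite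
line `v 0, v 1, v 2, …`. -/
structure IsSchreierLine {m : ℕ} (ξ : ℕ → BinaryEpi m) (v : ℕ → TreeBoundary) : Prop where
  start : v 0 = rightmostPoint
  injective : Function.Injective v
  range_eq : Set.range v = MulAction.orbit (spinalGroup ξ) rightmostPoint
  adj_iff : ∀ i j, i ≠ j →
    ((schreierLabels (spinalGenerators ξ) (v i) (v j)).Nonempty ↔ j = i + 1 ∨ i = j + 1)

/-- `η` is the one-sided infinite word read on the orbital Schreier graph rooted at `1^∞`. -/
def IsSchreierWord {m : ℕ} (ξ : ℕ → BinaryEpi m) (η : ℕ → SpinalLetter m) : Prop :=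
  ∃ v : ℕ → TreeBoundary, IsSchreierLine ξ v ∧
    ∀ i, schreierLabels (spinalGenerators ξ) (v i) (v (i + 1)) = letterLabels ξ (η i)

/-- The two-sided subshift associated with `G_ξ`, that is, the one given by the word read on the
orbital Schreier graph rooted at `1^∞`. -/
def spinalSubshift {m : ℕ} (ξ : ℕ → BinaryEpi m) : Set (ℤ → SpinalLetter m) :=
  {ω | ∃ η, IsSchreierWord ξ η ∧ ω ∈ wordSubshift η}

/-- The letters `α_φ` with `ξ_j = φ` for infinitely many `j`. -/
def spinalEventualAlphabet {m : ℕ} (ξ : ℕ → BinaryEpi m) : Set (SpinalLetter m) :=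
  {x | ∃ φ : BinaryEpi m, x = SpinalLetter.α φ ∧ ∃ᶠ j in Filter.atTop, ξ j = φ}

/-! ### Ruler words -/

section RulerWords

/-! The orbit of $1^\infty$ is enumerated by the reflected binary (Gray) code: `grayPoint i` is the
complement of the Gray code of $i$. Consecutive codes differ in one letter. If $i+1$ is odd, it is
the first, and `rootAut` changes it; if the exact power of two dividing $i+1$ is $2^{k+1}$, it is
the letter right after $1^k0$, which $b_\xi$ changes exactly when $\xi_k(b)\ne 0$
(`spinalBoundary_grayPoint`). So the letter read at $i$ depends only on the 2-adic valuation of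
$i+1$: the word is the ruler word of $a,\alpha_{\xi_0},\alpha_{\xi_1},\dots$
(`schreierLabels_grayPoint`). A line has only one enumeration from its end, and distinct letters
stand for distinct label sets, hence uniqueness (`isSchreierWord_iff`).

A ruler word is the limit of the doublings $p\mapsto p\,c_k\,p$. Merging doublings with equal
consecutive letters, a run of length $\ell$ becomes one Toeplitz step with $2^\ell$ blocks
(`toeplitzBlock_runStart`). Non-emptiness and aperiodicity are read off from valuations. At least
two letters recur, for otherwise a single epimorphism from a group of order $2^m>2$ onto $\mathbb
Z/2\mathbb Z$ would have trivial kernel. -/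

theorem padicValInt_two_eq {z : ℤ} {k : ℕ} {q : ℤ} (h : z = 2 ^ k * (2 * q + 1)) :
    padicValInt 2 z = k := by
  have hq : (2 * q + 1 : ℤ) ≠ 0 := by omega
  have h2 : ¬ (2 : ℤ) ∣ 2 * q + 1 := by omega
  rw [h, padicValInt.mul (pow_ne_zero _ two_ne_zero) hq,
    padicValInt.eq_zero_of_not_dvd (z := 2 * q + 1) (by exact_mod_cast h2)]
  have : (2 ^ k : ℤ) = ((2 ^ k : ℕ) : ℤ) := by push_cast; rfl
  rw [this, padicValInt.of_nat, padicValNat.prime_pow, add_zero]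

theorem exists_eq_two_pow_padicValInt_mul {z : ℤ} (hz : z ≠ 0) :
    ∃ q : ℤ, z = 2 ^ padicValInt 2 z * (2 * q + 1) := by
  obtain ⟨k, h, hk⟩ := (Int.finiteMultiplicity_iff.2
    ⟨by decide, hz⟩ : FiniteMultiplicity 2 z).exists_eq_pow_mul_and_not_dvd
  obtain ⟨q, rfl⟩ : Odd k := by
    rwa [← Int.not_even_iff_odd, even_iff_two_dvd]
  exact ⟨q, by rwa [padicValInt_two_eq h]⟩

theorem padicValInt_two_add {x y : ℤ} (hx : x ≠ 0) (h : 2 ^ (padicValInt 2 x + 1) ∣ y) :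
    padicValInt 2 (x + y) = padicValInt 2 x := by
  obtain ⟨q, hq⟩ := exists_eq_two_pow_padicValInt_mul hx
  obtain ⟨d, rfl⟩ := h
  apply padicValInt_two_eq (q := q + d)
  generalize padicValInt 2 x = k at *
  rw [hq]
  ring

theorem two_pow_padicValInt_le {z : ℤ} (hz : z ≠ 0) : 2 ^ padicValInt 2 z ≤ |z| :=
  Int.le_of_dvd (abs_pos.2 hz) ((dvd_abs _ _).2 (by exact_mod_cast padicValInt_dvd (p := 2) z))

variable {A : Type*}

/-- The one-sided word whose `i`-th letter is `c k`, where `2 ^ k` is the exact power of two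
dividing `i + 1`. -/
def rulerWord (c : ℕ → A) (i : ℕ) : A := c (padicValInt 2 ((i : ℤ) + 1))

/-- Since $0<r+1<2^k$, its valuation is below $k$ and is not affected by a multiple of $2^k$. -/
theorem rulerWord_add (c : ℕ → A) (k q r : ℕ) (hr : r < 2 ^ k - 1) :
    rulerWord c (q * 2 ^ k + r) = rulerWord c r := by
  have h : ((r : ℤ) + 1) ≠ 0 := by omega
  have h1 := two_pow_padicValInt_le h
  have h2 : padicValInt 2 ((r : ℤ) + 1) + 1 ≤ k := by
    rw [abs_of_nonneg (by omega)] at h1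
    have : 2 ^ padicValInt 2 ((r : ℤ) + 1) < 2 ^ k := by
      zify
      have := Nat.one_le_two_pow (n := k)
      zify [this] at hr
      omega
    exact (Nat.pow_lt_pow_iff_right (by norm_num)).1 this
  unfold rulerWord
  rw [← padicValInt_two_add h (y := q * 2 ^ k) (Dvd.dvd.mul_left (pow_dvd_pow _ h2) _)]
  congr 2
  push_cast
  ring

/-! ### Runs of equal letters and Toeplitz codings -/

/-- The next index at which the sequence takes another value. -/
noncomputable def runStart {c : ℕ → A} (h : ∀ k, ∃ l, k < l ∧ c l ≠ c k) : ℕ → ℕ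
  | 0 => 0
  | j + 1 => by
    classical exact Nat.find (h (runStart h j))

variable {c : ℕ → A} (h : ∀ k, ∃ l, k < l ∧ c l ≠ c k)

theorem runStart_lt_succ (j : ℕ) : runStart h j < runStart h (j + 1) := by
  classical exact (Nat.find_spec (h (runStart h j))).1

theorem runStart_succ_ne (j : ℕ) : c (runStart h (j + 1)) ≠ c (runStart h j) := by
  classical exact (Nat.find_spec (h (runStart h j))).2

theorem eq_of_mem_run {j l : ℕ} (h1 : runStart h j ≤ l) (h2 : l < runStart h (j + 1)) :
    c l = c (runStart h j) := by
  classical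
  by_contra hne
  have := Nat.find_min (h (runStart h j)) h2
  rcases h1.eq_or_lt with rfl | h1
  · exact hne rfl
  · exact this ⟨h1, hne⟩

theorem strictMono_runStart : StrictMono (runStart h) :=
  strictMono_nat_of_lt_succ (runStart_lt_succ h)

theorem exists_mem_run (l : ℕ) : ∃ j, runStart h j ≤ l ∧ l < runStart h (j + 1) := by
  induction l with
  | zero => exact ⟨0, le_rfl, (Nat.zero_le _).trans_lt (runStart_lt_succ h 0)⟩
  | succ l ih =>
    obtain ⟨j, h1, h2⟩ := ih
    rcases (Nat.succ_le_of_lt h2).eq_or_lt with h3 | h3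
    · exact ⟨j + 1, h3.ge, h3.trans_lt (runStart_lt_succ h _)⟩
    · exact ⟨j, by omega, h3⟩

theorem eventualAlphabet_runStart :
    eventualAlphabet (fun j => c (runStart h j)) = eventualAlphabet c := by
  ext x
  simp only [eventualAlphabet, Set.mem_ofPred_eq, Filter.frequently_atTop]
  constructor
  · intro hx N
    obtain ⟨j, hj, hjx⟩ := hx N
    exact ⟨_, hj.trans ((strictMono_runStart h).le_apply), hjx⟩
  · intro hx N
    obtain ⟨l, hl, hlx⟩ := hx (runStart h N)
    obtain ⟨j, h1, h2⟩ := exists_mem_run h l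
    refine ⟨j, ?_, (eq_of_mem_run h h1 h2).symm.trans hlx⟩
    have := (strictMono_runStart h).lt_iff_lt.1 (hl.trans_lt h2)
    omega

/-- The lengths of the runs of a sequence, as powers of two. -/
noncomputable def runPower (j : ℕ) : ℕ := 2 ^ (runStart h (j + 1) - runStart h j)

/-- All doublings within one run insert the same letter, so together they form a single Toeplitz
step. -/
theorem toeplitzBlock_runStart (j : ℕ) :
    toeplitzBlock (fun j => c (runStart h j)) (runPower h) j =
      (List.range (2 ^ runStart h j - 1)).map (rulerWord c) := by
  induction j with
  | zero => simp [toeplitzBlock, runStart]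
  | succ j ih =>
    rw [toeplitzBlock, ih]
    have hlt := runStart_lt_succ h j
    have hrun : ∀ l, runStart h j ≤ l → l < runStart h (j + 1) → c l = c (runStart h j) :=
      fun l => eq_of_mem_run h
    have hpow : 2 ^ runStart h (j + 1) = runPower h j * 2 ^ runStart h j := by
      rw [runPower, ← pow_add]; congr 1; omega
    have hP : runPower h j = 2 ^ (runStart h (j + 1) - runStart h j) := rfl
    generalize runStart h (j + 1) = K at *
    generalize runStart h j = k at *
    generalize runPower h j = P at *
    have hPpos : 0 < P := hP ▸ Nat.two_pow_pos _
    have hk := Nat.two_pow_pos k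
    have key : ∀ q, q < P → (List.replicate q
        ((List.range (2 ^ k - 1)).map (rulerWord c) ++ [c k])).flatten =
        (List.range (q * 2 ^ k)).map (rulerWord c) := by
      intro q hq
      induction q with
      | zero => simp
      | succ q ihq =>
        rw [List.replicate_succ', List.flatten_append, ihq (by omega), add_mul, one_mul,
          List.range_add, List.map_append]
        congr 1
        have h3 : 2 ^ k = (2 ^ k - 1) + 1 := by omega
        conv_rhs => rw [h3, List.range_succ]
        simp only [List.flatten_cons, List.flatten_nil, List.append_nil, List.map_append,
          List.map_map, List.map_cons, List.map_nil]
        congr 1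
        · apply List.map_congr_left
          intro r hr
          rw [Function.comp, ← h3, rulerWord_add c k q r (List.mem_range.1 hr)]
        · congr 1
          rw [← h3]
          have hz : ((q : ℤ) + 1) ≠ 0 := by omega
          obtain ⟨d, hd⟩ := exists_eq_two_pow_padicValInt_mul hz
          have hle := two_pow_padicValInt_le hz
          rw [abs_of_nonneg (by omega)] at hle
          -- The separator sits at $(q+1)2^k-1$. As $q+1<2^{K-k}$, the valuation $k+v(q+1)$ stays
          -- inside the run $[k,K)$, so its letter is $c_k$.
          have hlt' : padicValInt 2 ((q : ℤ) + 1) < K - k := by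
            rw [← Nat.pow_lt_pow_iff_right (a := 2) (by norm_num), ← hP]
            zify
            omega
          have hv : padicValInt 2 (((q * 2 ^ k + (2 ^ k - 1) : ℕ) : ℤ) + 1) =
              k + padicValInt 2 ((q : ℤ) + 1) := by
            apply padicValInt_two_eq (q := d)
            rw [pow_add, mul_assoc, ← hd]
            push_cast [Nat.cast_sub (Nat.one_le_two_pow (n := k))]
            ring
          rw [rulerWord, hv]
          exact (hrun _ (by omega) (by omega)).symm
    rw [key _ (by omega), hpow]
    have h5 : P * 2 ^ k - 1 = (P - 1) * 2 ^ k + (2 ^ k - 1) := by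
      obtain ⟨P, rfl⟩ : ∃ P', P = P' + 1 := ⟨P - 1, by omega⟩
      rw [Nat.add_sub_cancel, add_mul, one_mul]
      omega
    rw [h5, List.range_add, List.map_append, List.map_map]
    congr 1
    apply List.map_congr_left
    intro r hr
    rw [Function.comp, rulerWord_add c k _ r (List.mem_range.1 hr)]

theorem toeplitzWord_runStart :
    toeplitzWord (fun j => c (runStart h j)) (runPower h) = rulerWord c := by
  funext i
  rw [toeplitzWord, toeplitzBlock_runStart]
  have h1 : i + 1 ≤ runStart h (i + 1) := (strictMono_runStart h).le_apply
  have h2 : i + 1 < 2 ^ (i + 1) := Nat.lt_two_pow_self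
  have h3 := Nat.pow_le_pow_right (n := 2) (by norm_num) h1
  rw [List.getD_eq_getElem _ _ (by simp; omega)]
  simp

theorem isToeplitzCoding_runStart (hc : 2 ≤ (eventualAlphabet c).encard) :
    IsToeplitzCoding (fun j => c (runStart h j)) (runPower h) where
  two_le j := by
    have := runStart_lt_succ h j
    exact Nat.le_self_pow (by omega) 2
  succ_ne := runStart_succ_ne h
  two_le_card := by rwa [eventualAlphabet_runStart]

theorem exists_gt_ne_of_eventualAlphabet (hc : 2 ≤ (eventualAlphabet c).encard) (x : A) (k : ℕ) :
    ∃ l, k < l ∧ c l ≠ x := by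
  have h1 : 1 < (eventualAlphabet c).encard := lt_of_lt_of_le (by norm_num) hc
  obtain ⟨y, hy, hyx⟩ := Set.exists_ne_of_one_lt_encard h1 x
  obtain ⟨l, hl, rfl⟩ := Filter.frequently_atTop.1 hy (k + 1)
  exact ⟨l, hl, hyx⟩

theorem isSimpleToeplitz_rulerWord (hc : 2 ≤ (eventualAlphabet c).encard) :
    IsSimpleToeplitz (wordSubshift (rulerWord c)) (eventualAlphabet c) := by
  have h : ∀ k, ∃ l, k < l ∧ c l ≠ c k :=
    fun k => exists_gt_ne_of_eventualAlphabet hc _ k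
  exact ⟨_, _, isToeplitzCoding_runStart h hc, eventualAlphabet_runStart h,
    by rw [toeplitzWord_runStart]⟩

/-! ### Subshifts of ruler words -/

theorem mem_wordSubshift_iff {p : ℕ → A} {ω : ℤ → A} :
    ω ∈ wordSubshift p ↔
      ∀ (k : ℤ) (n : ℕ), ∃ l : ℕ, ∀ i < n, ω (k + (i : ℕ)) = p (l + i) := by
  constructor
  · intro h k n
    obtain ⟨l, hl⟩ := h (a := List.ofFn fun i : Fin n => ω (k + (i : ℕ)))
      ⟨k, by apply List.ext_getElem <;> simp⟩
    refine ⟨l, fun i hi => ?_⟩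
    have h1 := congrArg (fun w => w[i]?) hl
    simpa [hi] using h1
  · rintro h w ⟨k, hk⟩
    obtain ⟨l, hl⟩ := h k w.length
    refine ⟨l, hk.trans ?_⟩
    congr 1
    funext i
    exact hl i i.2

/-- Membership is a condition on each finite window separately, and any set of patterns on a finite
window is closed in the discrete topology. -/
theorem isSubshift_wordSubshift (p : ℕ → A) : IsSubshift (wordSubshift p) := by
  let : TopologicalSpace A := ⊥
  have : DiscreteTopology A := ⟨rfl⟩
  constructor
  · have : wordSubshift p = ⋂ (k : ℤ) (n : ℕ),
        (fun (ω : ℤ → A) (i : Fin n) => ω (k + (i : ℕ))) ⁻¹'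
          {w | ∃ l : ℕ, ∀ i : Fin n, w i = p (l + i)} := by
      ext ω
      simp only [mem_wordSubshift_iff, Set.mem_iInter, Set.mem_preimage, Set.mem_ofPred_eq,
        Fin.forall_iff]
    change IsClosed (wordSubshift p)
    rw [this]
    refine isClosed_iInter fun k => isClosed_iInter fun n => ?_
    refine (isClosed_discrete _).preimage ?_
    exact continuous_pi fun i => continuous_apply _
  · ext ω
    constructor
    · rintro ⟨σ, hσ, rfl⟩
      rw [mem_wordSubshift_iff] at hσ ⊢
      intro k n
      obtain ⟨l, hl⟩ := hσ (k + 1) n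
      refine ⟨l, fun i hi => ?_⟩
      rw [← hl i hi, shiftMap]
      congr 1
      ring
    · intro hω
      refine ⟨fun n => ω (n - 1), ?_, by funext n; simp [shiftMap]⟩
      rw [mem_wordSubshift_iff] at hω ⊢
      intro k n
      obtain ⟨l, hl⟩ := hω (k - 1) n
      refine ⟨l, fun i hi => ?_⟩
      rw [← hl i hi]
      congr 1
      ring

theorem wordSubshift_rulerWord_nonempty (hc : (eventualAlphabet c).Nonempty) :
    (wordSubshift (rulerWord c)).Nonempty := by
  obtain ⟨x, hx⟩ := hc
  -- The ruler sequence extends to all nonzero integers; at $0$, of infinite valuation, a recurring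
  -- letter is placed.
  refine ⟨fun n => if n = 0 then x else c (padicValInt 2 n), ?_⟩
  rw [mem_wordSubshift_iff]
  intro k n
  -- Translation by $2^K$ with $c_K=x$ and $K$ larger than all $|k+i|$ moves the window into the
  -- one-sided word: nonzero positions keep their valuation, and $0$ acquires valuation $K$.
  obtain ⟨K, hK, rfl⟩ := Filter.frequently_atTop.1 hx (k.natAbs + n + 1)
  have hKlt : K < 2 ^ K := Nat.lt_two_pow_self
  refine ⟨((2 : ℤ) ^ K + k - 1).toNat, fun i hi => ?_⟩
  have hKlt' : (K : ℤ) < 2 ^ K := by exact_mod_cast hKlt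
  have hcast : (((((2 : ℤ) ^ K + k - 1).toNat + i : ℕ) : ℤ)) + 1 = (k + i) + 2 ^ K := by
    push_cast
    rw [Int.toNat_of_nonneg (by omega)]
    ring
  rw [rulerWord, hcast]
  split_ifs with h0
  · rw [h0, zero_add]
    congr 1
    exact (padicValInt_two_eq (q := 0) (by ring)).symm
  · rw [padicValInt_two_add h0]
    apply pow_dvd_pow
    have h1 := two_pow_padicValInt_le h0
    have h2 : (padicValInt 2 (k + i) : ℤ) < 2 ^ padicValInt 2 (k + i) := by
      exact_mod_cast Nat.lt_two_pow_self
    have h3 : |k + (i : ℤ)| < K := by rw [abs_lt]; omega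
    omega

theorem shiftMap_iterate (q : ℕ) (ω : ℤ → A) (n : ℤ) : shiftMap^[q] ω n = ω (n + q) := by
  induction q generalizing ω with
  | zero => simp
  | succ q ih =>
    rw [Function.iterate_succ, Function.comp, ih, shiftMap]
    congr 1
    push_cast
    ring

theorem isAperiodic_rulerWord (hc : 2 ≤ (eventualAlphabet c).encard) :
    IsAperiodic (wordSubshift (rulerWord c)) := by
  intro ω hω q hq hper
  have hq0 : (q : ℤ) ≠ 0 := by omega
  -- A position of valuation exactly $t>v(q)$ has valuation $v(q)$ after adding $q$, so period $q$
  -- would force $c_t=c_{v(q)}$.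
  obtain ⟨t, hst, hne⟩ := exists_gt_ne_of_eventualAlphabet hc (c (padicValInt 2 q))
    (padicValInt 2 q)
  obtain ⟨l, hl⟩ := mem_wordSubshift_iff.1 hω 0 (2 ^ (t + 1) + q)
  -- Any $2^{t+1}$ consecutive integers include one congruent to $2^t$ modulo $2^{t+1}$.
  have ⟨j, hj, z, hz⟩ : ∃ j < 2 ^ (t + 1), ∃ z : ℤ,
      ((l + j : ℕ) : ℤ) + 1 = 2 ^ t * (2 * z + 1) := by
    refine ⟨(((2 : ℤ) ^ t - 1 - l) % (2 ^ (t + 1))).toNat, ?_, -(((2 : ℤ) ^ t - 1 - l) / (2 ^ (t + 1))), ?_⟩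
    · have h1 := Int.emod_lt_of_pos ((2 : ℤ) ^ t - 1 - l) (b := 2 ^ (t + 1)) (by positivity)
      have h2 := Int.emod_nonneg ((2 : ℤ) ^ t - 1 - l) (b := 2 ^ (t + 1)) (by positivity)
      zify
      rwa [Int.toNat_of_nonneg h2]
    · have h2 := Int.emod_nonneg ((2 : ℤ) ^ t - 1 - l) (b := 2 ^ (t + 1)) (by positivity)
      push_cast
      rw [Int.toNat_of_nonneg h2]
      have := Int.emod_add_mul_ediv ((2 : ℤ) ^ t - 1 - l) (2 ^ (t + 1))
      linear_combination this
  have e1 := hl j (by omega)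
  have e2 := hl (j + q) (by omega)
  have e3 : ω (0 + (j : ℕ)) = ω (0 + (j + q : ℕ)) := by
    conv_lhs => rw [← hper, shiftMap_iterate]
    congr 1
    push_cast
    ring
  have v1 : rulerWord c (l + j) = c t := by
    rw [rulerWord, padicValInt_two_eq hz]
  have v2 : rulerWord c (l + (j + q)) = c (padicValInt 2 q) := by
    rw [rulerWord]
    have : ((l + (j + q) : ℕ) : ℤ) + 1 = q + 2 ^ t * (2 * z + 1) := by
      rw [← hz]; push_cast; ring
    rw [this, padicValInt_two_add hq0 (Dvd.dvd.mul_right (pow_dvd_pow _ hst) _)]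
  exact hne (by rw [← v1, ← e1, e3, e2, v2])

end RulerWords

/-! ### The action of the generators on the boundary -/

section BoundaryAction

/-- The action on the boundary of the tree of the map `spinalFun t`. -/
def spinalBoundary (t : ℕ → ZMod 2) (x : TreeBoundary) : TreeBoundary :=
  fun n => (spinalFun t (rayVertex x (n + 1))).getD n 0

theorem rayVertex_succ (x : TreeBoundary) (n : ℕ) :
    rayVertex x (n + 1) = x 0 :: rayVertex (fun i => x (i + 1)) n := by
  simp [rayVertex, List.ofFn_succ]

theorem rotateRoot_rayVertex_getD (s : ZMod 2) (x : TreeBoundary) (n : ℕ) :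
    (rotateRoot s (rayVertex x (n + 1))).getD n 0 = if n = 0 then x 0 + s else x n := by
  rw [rayVertex_succ, rotateRoot]
  cases n with
  | zero => simp
  | succ n =>
    have h : (x 0 :: rayVertex (fun i => x (i + 1)) (n + 1)).getD (n + 1) 0 = x (n + 1) := by
      rw [← rayVertex_succ, rayVertex, List.getD_eq_getElem _ _ (by simp), List.getElem_ofFn]
    rwa [List.getD_cons_succ] at h ⊢

theorem rootAut_smul_apply (x : TreeBoundary) (n : ℕ) :
    (rootAut • x) n = if n = 0 then x 0 + 1 else x n :=
  rotateRoot_rayVertex_getD 1 x n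

theorem spinalBoundary_zero (t : ℕ → ZMod 2) (x : TreeBoundary) : spinalBoundary t x 0 = x 0 := by
  simp [spinalBoundary, rayVertex_succ, spinalFun]

theorem spinalBoundary_succ_of_eq_one (t : ℕ → ZMod 2) {x : TreeBoundary} (h : x 0 = 1) (n : ℕ) :
    spinalBoundary t x (n + 1) =
      spinalBoundary (fun r => t (r + 1)) (fun i => x (i + 1)) n := by
  rw [spinalBoundary, rayVertex_succ, spinalFun, if_pos h, List.getD_cons_succ]
  rfl

theorem spinalBoundary_succ_of_ne_one (t : ℕ → ZMod 2) {x : TreeBoundary} (h : x 0 ≠ 1) (n : ℕ) :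
    spinalBoundary t x (n + 1) = if n = 0 then x 1 + t 0 else x (n + 1) := by
  rw [spinalBoundary, rayVertex_succ, spinalFun, if_neg h, List.getD_cons_succ,
    rotateRoot_rayVertex_getD]

theorem spinalBoundary_rightmostPoint (t : ℕ → ZMod 2) :
    spinalBoundary t rightmostPoint = rightmostPoint := by
  funext n
  induction n generalizing t with
  | zero => exact spinalBoundary_zero _ _
  | succ n ih =>
    rw [spinalBoundary_succ_of_eq_one t rfl]
    exact ih _

/-! ### The Gray code -/

/-- The `i`-th point of the line: the complement of the reflected binary code of `i`. -/
def grayPoint (i : ℕ) : TreeBoundary :=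
  fun n => 1 + ((i / 2 ^ n : ℕ) : ZMod 2) + ((i / 2 ^ (n + 1) : ℕ) : ZMod 2)

theorem grayPoint_zero : grayPoint 0 = rightmostPoint := by
  funext n
  simp [grayPoint, rightmostPoint]

theorem grayPoint_succ (i n : ℕ) : grayPoint i (n + 1) = grayPoint (i / 2) n := by
  simp only [grayPoint, Nat.div_div_eq_div_mul]
  rw [← pow_succ', ← pow_succ']

theorem grayPoint_apply_zero (i : ℕ) : grayPoint i 0 = 1 + (i : ZMod 2) + ((i / 2 : ℕ) : ZMod 2) := by
  simp [grayPoint]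

theorem grayPoint_injective : Function.Injective grayPoint := by
  intro i
  induction i using Nat.strong_induction_on with
  | _ i ih =>
    intro j hij
    have h2 : grayPoint (i / 2) = grayPoint (j / 2) := by
      funext n
      rw [← grayPoint_succ, ← grayPoint_succ, hij]
    have h0 : ((i : ℕ) : ZMod 2) + ((i / 2 : ℕ) : ZMod 2) =
        ((j : ℕ) : ZMod 2) + ((j / 2 : ℕ) : ZMod 2) := by
      have := congrFun hij 0
      rwa [grayPoint_apply_zero, grayPoint_apply_zero, add_assoc, add_assoc, add_right_inj] at this
    -- The tail determines $\lfloor i/2\rfloor$ and the first letter then the parity. Halving does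
    -- not decrease $0$, so that case needs its own induction on $j$.
    rcases Nat.eq_zero_or_pos i with rfl | hi
    · clear ih
      have h3 : ∀ j : ℕ, grayPoint 0 = grayPoint j → j = 0 := by
        intro j
        induction j using Nat.strong_induction_on with
        | _ j ihj =>
          intro hj
          by_contra hne
          have h4 : j / 2 = 0 := ihj _ (by omega) (by
            funext n
            rw [← grayPoint_succ, ← hj, grayPoint_succ])
          have h5 : j = 1 := by omega
          subst h5
          have := congrFun hj 0
          revert this
          simp [grayPoint]
      exact (h3 j hij).symm
    · have h1 := ih (i / 2) (by omega) h2
      rw [h1, add_left_inj, ZMod.natCast_eq_natCast_iff'] at h0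
      omega

theorem rootAut_smul_grayPoint (q : ℕ) :
    rootAut • grayPoint (2 * q) = grayPoint (2 * q + 1) := by
  funext n
  rw [rootAut_smul_apply]
  have h1 : (2 * q + 1) / 2 = q := by omega
  have h2 : 2 * q / 2 = q := by omega
  cases n with
  | zero =>
    rw [if_pos rfl, grayPoint_apply_zero, grayPoint_apply_zero, h1, h2]
    push_cast
    ring
  | succ n => rw [if_neg n.succ_ne_zero, grayPoint_succ, grayPoint_succ, h1, h2]

theorem natCast_two_mul_zmod (q : ℕ) : ((2 * q : ℕ) : ZMod 2) = 0 := by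
  rw [ZMod.natCast_eq_zero_iff]
  exact dvd_mul_right _ _

theorem natCast_two_mul_add_one_zmod (q : ℕ) : ((2 * q + 1 : ℕ) : ZMod 2) = 1 := by
  rw [Nat.cast_succ, natCast_two_mul_zmod, zero_add]

/-- Both `grayPoint i` and `grayPoint (i + 1)`, where `2 ^ (k + 1)` is the exact power of two
dividing `i + 1`, lie below the vertex `1ᵏ0`, and they differ in the next letter only. -/
theorem spinalBoundary_grayPoint (t : ℕ → ZMod 2) (k q i : ℕ)
    (hi : i + 1 = 2 ^ (k + 1) * (2 * q + 1)) :
    (t k = 1 → spinalBoundary t (grayPoint i) = grayPoint (i + 1)) ∧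
      (t k = 0 → spinalBoundary t (grayPoint i) = grayPoint i ∧
        spinalBoundary t (grayPoint (i + 1)) = grayPoint (i + 1)) := by
  induction k generalizing t i with
  | zero =>
    -- Here both points start with $0$, and their tails are the points $2q$ and $2q+1$, exchanged by
    -- `rootAut`.
    obtain rfl : i = 2 * (2 * q) + 1 := by omega
    have d1 : (2 * (2 * q) + 1) / 2 = 2 * q := by omega
    have d2 : (2 * (2 * q) + 1 + 1) / 2 = 2 * q + 1 := by omega
    have h0 : grayPoint (2 * (2 * q) + 1) 0 = 0 := by
      rw [grayPoint_apply_zero, d1, natCast_two_mul_add_one_zmod, natCast_two_mul_zmod]; rfl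
    have h1 : grayPoint (2 * (2 * q) + 1 + 1) 0 = 0 := by
      rw [grayPoint_apply_zero, d2, natCast_two_mul_add_one_zmod,
        show 2 * (2 * q) + 1 + 1 = 2 * (2 * q + 1) by ring, natCast_two_mul_zmod]; rfl
    have hr := rootAut_smul_grayPoint q
    refine ⟨fun ht => ?_, fun ht => ⟨?_, ?_⟩⟩ <;> funext n <;> cases n with
    | zero => simp only [spinalBoundary_zero, h0, h1]
    | succ n =>
      rw [spinalBoundary_succ_of_ne_one t (by simp [h0, h1]), ht]
      first
      | rw [grayPoint_succ, grayPoint_succ, grayPoint_succ, d1, d2, ← hr, rootAut_smul_apply]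
      | (rw [add_zero]; split_ifs with hn
         · rw [hn]
         · rfl)
  | succ k ih =>
    -- With $i=2j+1$ and $j$ odd, both points start with $1$ and have tails `grayPoint j` and
    -- `grayPoint (j + 1)`; the claim descends to these with $t$ shifted.
    obtain ⟨j, hj⟩ : ∃ j, j + 1 = 2 ^ (k + 1) * (2 * q + 1) :=
      ⟨2 ^ (k + 1) * (2 * q + 1) - 1, Nat.sub_add_cancel (Nat.succ_le_of_lt (Nat.mul_pos (by positivity) (by omega)))⟩
    obtain ⟨l, hl⟩ : ∃ l, j = 2 * l + 1 := by
      rw [pow_succ', mul_assoc] at hj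
      exact ⟨2 ^ k * (2 * q + 1) - 1, by omega⟩
    have hij : i = 2 * j + 1 := by
      rw [pow_succ', mul_assoc, ← hj] at hi
      omega
    subst hij
    have d1 : (2 * j + 1) / 2 = j := by omega
    have d2 : (2 * j + 1 + 1) / 2 = j + 1 := by omega
    have h0 : grayPoint (2 * j + 1) 0 = 1 := by
      rw [grayPoint_apply_zero, d1, natCast_two_mul_add_one_zmod, hl,
        natCast_two_mul_add_one_zmod]; rfl
    have h1 : grayPoint (2 * j + 1 + 1) 0 = 1 := by
      rw [grayPoint_apply_zero, d2, show 2 * j + 1 + 1 = 2 * (j + 1) by ring,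
        natCast_two_mul_zmod, hl, show 2 * l + 1 + 1 = 2 * (l + 1) by ring,
        natCast_two_mul_zmod]; rfl
    obtain ⟨ih1, ih2⟩ := ih (fun r => t (r + 1)) j hj
    have t1 : (fun i => grayPoint (2 * j + 1) (i + 1)) = grayPoint j := by
      funext n; rw [grayPoint_succ, d1]
    have t2 : (fun i => grayPoint (2 * j + 1 + 1) (i + 1)) = grayPoint (j + 1) := by
      funext n; rw [grayPoint_succ, d2]
    refine ⟨fun ht => ?_, fun ht => ⟨?_, ?_⟩⟩ <;> funext n <;> cases n with
    | zero => simp only [spinalBoundary_zero, h0, h1]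
    | succ n =>
      rw [spinalBoundary_succ_of_eq_one t (by simp only [h0, h1])]
      first
      | rw [t1, ih1 ht, grayPoint_succ, d2]
      | rw [t1, (ih2 ht).1, grayPoint_succ, d1]
      | rw [t2, (ih2 ht).2, grayPoint_succ, d2]

theorem exists_two_pow_mul_of_odd (q : ℕ) :
    ∃ k r : ℕ, 2 * q + 1 + 1 = 2 ^ (k + 1) * (2 * r + 1) := by
  obtain ⟨k, m, ⟨r, rfl⟩, h⟩ := Nat.exists_eq_two_pow_mul_odd (n := q + 1) (by omega)
  exact ⟨k, r, by rw [pow_succ', mul_assoc, ← h]; ring⟩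

end BoundaryAction

/-! ### The Schreier graph -/

section SchreierGraph

variable {m : ℕ} {ξ : ℕ → BinaryEpi m}

theorem spinalAut_smul (b : Fin m → ZMod 2) (x : TreeBoundary) :
    spinalAut ξ b • x = spinalBoundary (fun r => (ξ r).1 b) x := rfl

theorem rootAut_mul_self : rootAut * rootAut = 1 :=
  Subtype.ext (Equiv.ext (rotateRoot_involutive 1))

theorem smul_smul_of_mem_spinalGenerators {s : treeAut} (hs : s ∈ spinalGenerators ξ)
    (x : TreeBoundary) : s • s • x = x := by
  have : s * s = 1 := by
    rcases hs with rfl | ⟨⟨b, rfl⟩, -⟩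
    · exact rootAut_mul_self
    · exact Subtype.ext (Equiv.ext (spinalFun_involutive _))
  rw [smul_smul, this, one_smul]

theorem rootAut_ne_spinalAut (b : Fin m → ZMod 2) : rootAut ≠ spinalAut ξ b := by
  intro h
  have h1 : rootAut • rightmostPoint = rightmostPoint := by
    rw [h, spinalAut_smul, spinalBoundary_rightmostPoint]
  have h2 := congrFun h1 0
  rw [rootAut_smul_apply, if_pos rfl] at h2
  revert h2
  decide

theorem rootAut_smul_grayPoint_odd (q : ℕ) :
    rootAut • grayPoint (2 * q + 1) = grayPoint (2 * q) := by
  rw [← rootAut_smul_grayPoint, smul_smul, rootAut_mul_self, one_smul]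

theorem spinalAut_smul_grayPoint {b : Fin m → ZMod 2} {k q i : ℕ}
    (hi : i + 1 = 2 ^ (k + 1) * (2 * q + 1)) :
    ((ξ k).1 b ≠ 0 → spinalAut ξ b • grayPoint i = grayPoint (i + 1)) ∧
      ((ξ k).1 b = 0 → spinalAut ξ b • grayPoint i = grayPoint i ∧
        spinalAut ξ b • grayPoint (i + 1) = grayPoint (i + 1)) := by
  have h := spinalBoundary_grayPoint (fun r => (ξ r).1 b) k q i hi
  refine ⟨fun hb => h.1 ?_, h.2⟩
  have : ∀ z : ZMod 2, z ≠ 0 → z = 1 := by decide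
  exact this _ hb

theorem spinalAut_mem_spinalGenerators {b : Fin m → ZMod 2} {k : ℕ} (hb : (ξ k).1 b ≠ 0) :
    spinalAut ξ b ∈ spinalGenerators ξ := by
  refine Or.inr ⟨⟨b, rfl⟩, fun h => ?_⟩
  have hpos : 0 < 2 ^ (k + 1) := by positivity
  have h1 := (spinalAut_smul_grayPoint (ξ := ξ) (b := b) (k := k) (q := 0)
    (i := 2 ^ (k + 1) - 1) (by omega)).1 hb
  rw [Set.mem_singleton_iff.1 h, one_smul] at h1
  have := grayPoint_injective h1
  omega

/-- The letters `a, α_{ξ 0}, α_{ξ 1}, …`. -/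
def spinalLetters (ξ : ℕ → BinaryEpi m) : ℕ → SpinalLetter m
  | 0 => .a
  | k + 1 => .α (ξ k)

/-- Every generator maps a point of the line to itself or to a neighbour. -/
theorem smul_grayPoint_cases {s : treeAut} (hs : s ∈ spinalGenerators ξ) (i : ℕ) :
    s • grayPoint i = grayPoint i ∨ s • grayPoint i = grayPoint (i + 1) ∨
      ∃ j, i = j + 1 ∧ s • grayPoint i = grayPoint j := by
  have hs' := hs
  rcases hs with rfl | ⟨⟨b, rfl⟩, -⟩
  · rcases Nat.even_or_odd' i with ⟨q, rfl | rfl⟩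
    · exact Or.inr (Or.inl (rootAut_smul_grayPoint q))
    · exact Or.inr (Or.inr ⟨_, rfl, rootAut_smul_grayPoint_odd q⟩)
  · rcases Nat.even_or_odd' i with ⟨q, rfl | rfl⟩
    · cases q with
      | zero => left; rw [mul_zero, grayPoint_zero, spinalAut_smul, spinalBoundary_rightmostPoint]
      | succ q =>
        obtain ⟨k, r, h⟩ := exists_two_pow_mul_of_odd q
        have h2 := spinalAut_smul_grayPoint (ξ := ξ) (b := b) h
        by_cases hb : (ξ k).1 b = 0
        · exact Or.inl (h2.2 hb).2
        · refine Or.inr (Or.inr ⟨2 * q + 1, rfl, ?_⟩)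
          rw [show 2 * (q + 1) = 2 * q + 1 + 1 by ring, ← h2.1 hb,
            smul_smul_of_mem_spinalGenerators hs']
    · obtain ⟨k, r, h⟩ := exists_two_pow_mul_of_odd q
      have h2 := spinalAut_smul_grayPoint (ξ := ξ) (b := b) h
      by_cases hb : (ξ k).1 b = 0
      · exact Or.inl (h2.2 hb).1
      · exact Or.inr (Or.inl (h2.1 hb))

theorem spinalAut_smul_grayPoint_even (b : Fin m → ZMod 2) (q : ℕ) :
    spinalAut ξ b • grayPoint (2 * q) ≠ grayPoint (2 * q + 1) := by
  intro h
  cases q with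
  | zero =>
    rw [mul_zero, grayPoint_zero, spinalAut_smul, spinalBoundary_rightmostPoint,
      ← grayPoint_zero] at h
    exact absurd (grayPoint_injective h) (by omega)
  | succ q =>
    obtain ⟨k, r, hk⟩ := exists_two_pow_mul_of_odd q
    have h2 := spinalAut_smul_grayPoint (ξ := ξ) (b := b) hk
    rw [show 2 * (q + 1) = 2 * q + 1 + 1 by ring] at h
    by_cases hb : (ξ k).1 b = 0
    · rw [(h2.2 hb).2] at h
      exact absurd (grayPoint_injective h) (by omega)
    · rw [← h2.1 hb, smul_smul_of_mem_spinalGenerators (spinalAut_mem_spinalGenerators hb)] at h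
      exact absurd (grayPoint_injective h) (by omega)

/-- The root swap pairs $2q$ with $2q+1$, while the $b_\xi$ can only pair $2q+1$ with $2q+2$; hence
the two kinds of labels never share an edge of the line. -/
theorem schreierLabels_grayPoint (i : ℕ) :
    schreierLabels (spinalGenerators ξ) (grayPoint i) (grayPoint (i + 1)) =
      letterLabels ξ (rulerWord (spinalLetters ξ) i) := by
  rcases Nat.even_or_odd' i with ⟨q, rfl | rfl⟩
  · have hv : padicValInt 2 (((2 * q : ℕ) : ℤ) + 1) = 0 :=
      padicValInt_two_eq (q := q) (by push_cast; ring)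
    rw [rulerWord, hv]
    ext s
    constructor
    · rintro ⟨rfl | ⟨⟨b, rfl⟩, -⟩, h⟩
      · rfl
      · exact absurd h (spinalAut_smul_grayPoint_even b q)
    · rintro rfl
      exact ⟨Or.inl rfl, rootAut_smul_grayPoint q⟩
  · obtain ⟨k, r, hk⟩ := exists_two_pow_mul_of_odd q
    have hv : padicValInt 2 (((2 * q + 1 : ℕ) : ℤ) + 1) = k + 1 :=
      padicValInt_two_eq (q := r) (by exact_mod_cast hk)
    rw [rulerWord, hv]
    ext s
    constructor
    · rintro ⟨rfl | ⟨⟨b, rfl⟩, -⟩, h⟩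
      · rw [rootAut_smul_grayPoint_odd] at h
        exact absurd (grayPoint_injective h) (by omega)
      · refine ⟨b, fun hb => ?_, rfl⟩
        rw [((spinalAut_smul_grayPoint hk).2 hb).1] at h
        exact absurd (grayPoint_injective h) (by omega)
    · rintro ⟨b, hb, rfl⟩
      exact ⟨spinalAut_mem_spinalGenerators hb, (spinalAut_smul_grayPoint hk).1 hb⟩

theorem letterLabels_nonempty (x : SpinalLetter m) : (letterLabels ξ x).Nonempty := by
  cases x with
  | a => exact ⟨_, rfl⟩
  | α φ =>
    obtain ⟨b, hb⟩ := φ.2 1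
    exact ⟨_, b, by simp [hb], rfl⟩

theorem isSchreierLine_grayPoint (ξ : ℕ → BinaryEpi m) : IsSchreierLine ξ grayPoint where
  start := grayPoint_zero
  injective := grayPoint_injective
  range_eq := by
    ext x
    constructor
    · rintro ⟨i, rfl⟩
      induction i with
      | zero => rw [grayPoint_zero]; exact MulAction.mem_orbit_self _
      | succ i ih =>
        obtain ⟨s, hs⟩ : (schreierLabels (spinalGenerators ξ) (grayPoint i)
            (grayPoint (i + 1))).Nonempty := by
          rw [schreierLabels_grayPoint]; exact letterLabels_nonempty _
        obtain ⟨g, hg⟩ := ih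
        refine ⟨⟨s, Subgroup.subset_closure hs.1⟩ * g, ?_⟩
        exact (mul_smul s g.1 rightmostPoint).trans ((congrArg (s • ·) hg).trans hs.2)
    · rintro ⟨⟨g, hg⟩, rfl⟩
      change g • rightmostPoint ∈ _
      rw [← grayPoint_zero]
      have gen : ∀ s ∈ spinalGenerators ξ, ∀ i, s • grayPoint i ∈ Set.range grayPoint := by
        intro s hs i
        rcases smul_grayPoint_cases hs i with h | h | ⟨j, -, h⟩ <;> exact ⟨_, h.symm⟩
      -- Invariance of the whole line, not just the image of its end, is what passes to products.
      suffices ∀ i, g • grayPoint i ∈ Set.range grayPoint from this 0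
      induction hg using Subgroup.closure_induction'' with
      | mem s hs => exact gen s hs
      | inv_mem s hs =>
        intro i
        rw [show s⁻¹ • grayPoint i = s • grayPoint i by
          rw [inv_smul_eq_iff, smul_smul_of_mem_spinalGenerators hs]]
        exact gen s hs i
      | one => intro i; rw [one_smul]; exact ⟨i, rfl⟩
      | mul g h _ _ ihg ihh =>
        intro i
        obtain ⟨j, hj⟩ := ihh i
        rw [mul_smul, ← hj]
        exact ihg j
  adj_iff i j hij := by
    constructor
    · rintro ⟨s, hs, h⟩
      rcases smul_grayPoint_cases hs i with h' | h' | ⟨l, rfl, h'⟩ <;> rw [h'] at h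
      · exact absurd (grayPoint_injective h) hij
      · exact Or.inl (grayPoint_injective h).symm
      · exact Or.inr (by rw [grayPoint_injective h])
    · have key : ∀ i, (schreierLabels (spinalGenerators ξ) (grayPoint i)
          (grayPoint (i + 1))).Nonempty := fun i => by
        rw [schreierLabels_grayPoint]; exact letterLabels_nonempty _
      rintro (rfl | rfl)
      · exact key i
      · obtain ⟨s, hs, h⟩ := key j
        exact ⟨s, hs, by rw [← h, smul_smul_of_mem_spinalGenerators hs]⟩

/-! ### Uniqueness of the line and of the word -/

/-- Adjacency is intrinsic to the graph, and the next vertex is the only neighbour of the current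
one not yet visited. -/
theorem IsSchreierLine.unique {v w : ℕ → TreeBoundary} (hv : IsSchreierLine ξ v)
    (hw : IsSchreierLine ξ w) : v = w := by
  funext i
  induction i using Nat.strong_induction_on with
  | _ i ih =>
    cases i with
    | zero => rw [hv.start, hw.start]
    | succ i =>
      obtain ⟨k, hk⟩ : v (i + 1) ∈ Set.range w := by
        rw [hw.range_eq, ← hv.range_eq]; exact ⟨_, rfl⟩
      have hlt : ∀ j ≤ i, k ≠ j := by
        rintro j hj rfl
        rw [← ih k (by omega)] at hk
        exact absurd (hv.injective hk) (by omega)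
      have hadj := (hv.adj_iff i (i + 1) (by omega)).2 (Or.inl rfl)
      rw [ih i (by omega), ← hk, hw.adj_iff i k (hlt i le_rfl).symm] at hadj
      rcases hadj with rfl | h
      · exact hk.symm
      · exact absurd rfl (hlt k (by omega))

/-- Whether $b_\xi$ moves the point with index $2^{k+1}-1$ tells whether $\xi_k(b)\ne 0$, so $b_\xi$
determines $b$ modulo the intersection of all kernels. -/
theorem spinalAut_injective (hξ : ξ ∈ spinalParameters m) : Function.Injective (spinalAut ξ) := by
  intro b b' h
  have key : ∀ k, (ξ k).1 (b - b') = 0 := by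
    intro k
    have hpos : 0 < 2 ^ (k + 1) := by positivity
    have hi : 2 ^ (k + 1) - 1 + 1 = 2 ^ (k + 1) * (2 * 0 + 1) := by omega
    have h1 := spinalAut_smul_grayPoint (ξ := ξ) (b := b) hi
    have h2 := spinalAut_smul_grayPoint (ξ := ξ) (b := b') hi
    rw [← h] at h2
    have hne : ¬ grayPoint (2 ^ (k + 1) - 1) = grayPoint (2 ^ (k + 1) - 1 + 1) :=
      fun h => absurd (grayPoint_injective h) (by omega)
    have hz : ∀ x y : ZMod 2, (x = 0 ↔ y = 0) → x - y = 0 := by decide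
    rw [map_sub]
    refine hz _ _ ⟨fun hb => ?_, fun hb => ?_⟩
    · by_contra hb'
      exact hne ((h1.2 hb).1.symm.trans (h2.1 hb'))
    · by_contra hb'
      exact hne ((h2.2 hb).1.symm.trans (h1.1 hb'))
  have h0 : b - b' ∈ ⨅ j, ⨅ _ : 0 ≤ j, (ξ j).1.ker := by
    simp only [AddSubgroup.mem_iInf, AddMonoidHom.mem_ker]
    exact fun j _ => key j
  rw [hξ 0, AddSubgroup.mem_bot] at h0
  exact sub_eq_zero.1 h0

/-- `rootAut` is no $b_\xi$, and a homomorphism to $\mathbb Z/2\mathbb Z$ is determined by the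
complement of its kernel. -/
theorem letterLabels_injective (hξ : ξ ∈ spinalParameters m) :
    Function.Injective (letterLabels ξ) := by
  have ha : ∀ φ : BinaryEpi m, letterLabels ξ .a ≠ letterLabels ξ (.α φ) := by
    intro φ h
    obtain ⟨b, -, hb⟩ : rootAut ∈ letterLabels ξ (.α φ) := h ▸ rfl
    exact rootAut_ne_spinalAut b hb.symm
  rintro (_ | φ) (_ | ψ) h
  · rfl
  · exact absurd h (ha ψ)
  · exact absurd h.symm (ha φ)
  · have h1 := (spinalAut_injective hξ).image_injective h
    congr 1
    refine Subtype.ext (AddMonoidHom.ext fun b => ?_)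
    have h2 : φ.1 b ≠ 0 ↔ ψ.1 b ≠ 0 := Set.ext_iff.1 h1 b
    have hz : ∀ x y : ZMod 2, (x ≠ 0 ↔ y ≠ 0) → x = y := by decide
    exact hz _ _ h2

theorem isSchreierWord_iff (hξ : ξ ∈ spinalParameters m) {η : ℕ → SpinalLetter m} :
    IsSchreierWord ξ η ↔ η = rulerWord (spinalLetters ξ) := by
  constructor
  · rintro ⟨v, hv, h⟩
    rw [hv.unique (isSchreierLine_grayPoint ξ)] at h
    funext i
    apply letterLabels_injective hξ
    rw [← h, schreierLabels_grayPoint]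
  · rintro rfl
    exact ⟨_, isSchreierLine_grayPoint ξ, schreierLabels_grayPoint⟩

theorem spinalSubshift_eq (hξ : ξ ∈ spinalParameters m) :
    spinalSubshift ξ = wordSubshift (rulerWord (spinalLetters ξ)) := by
  ext ω
  constructor
  · rintro ⟨η, hη, h⟩
    rwa [(isSchreierWord_iff hξ).1 hη] at h
  · exact fun h => ⟨_, (isSchreierWord_iff hξ).2 rfl, h⟩

/-! ### The eventual alphabet -/

theorem eventualAlphabet_spinalLetters (ξ : ℕ → BinaryEpi m) :
    eventualAlphabet (spinalLetters ξ) = spinalEventualAlphabet ξ := by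
  ext x
  change (∃ᶠ k in Filter.atTop, spinalLetters ξ k = x) ↔ _
  -- Dropping index $0$ removes the only occurrence of $a$ and aligns the letters with $\xi$.
  rw [← Filter.map_add_atTop_eq_nat 1, Filter.frequently_map]
  cases x with
  | a => simp [spinalEventualAlphabet, spinalLetters]
  | α φ =>
    simp only [spinalLetters, SpinalLetter.α.injEq]
    exact ⟨fun h => ⟨φ, rfl, h⟩, fun ⟨_, h, h'⟩ => SpinalLetter.α.inj h ▸ h'⟩

theorem two_le_encard_spinalEventualAlphabet (hm : 2 ≤ m) (hξ : ξ ∈ spinalParameters m) :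
    2 ≤ (spinalEventualAlphabet ξ).encard := by
  have hev : ∀ᶠ k in Filter.atTop, spinalLetters ξ k ∈ spinalEventualAlphabet ξ := by
    rw [← eventualAlphabet_spinalLetters]
    have : ∀ x : SpinalLetter m, ∀ᶠ k in Filter.atTop,
        spinalLetters ξ k = x → x ∈ eventualAlphabet (spinalLetters ξ) := by
      intro x
      by_cases hx : x ∈ eventualAlphabet (spinalLetters ξ)
      · exact Filter.Eventually.of_forall fun _ _ => hx
      · filter_upwards [Filter.not_frequently.1 hx] with k hk h
        exact absurd h hk
    -- Finiteness of the alphabet gives one bound beyond which only recurring letters appear.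
    filter_upwards [Filter.eventually_all.2 this] with k hk using hk _ rfl
  obtain ⟨N, hN⟩ := Filter.eventually_atTop.1 hev
  by_contra! hlt
  have hsub : (spinalEventualAlphabet ξ).Subsingleton := by
    rw [← Set.encard_le_one_iff_subsingleton]
    exact Order.le_of_lt_succ hlt
  have hconst : ∀ k, N ≤ k → ξ k = ξ N := fun k hk =>
    SpinalLetter.α.inj (hsub (hN (k + 1) (by omega)) (hN (N + 1) (by omega)))
  -- For a constant tail, the intersection of the kernels is the kernel of $\xi_N$ alone.
  have hinj : Function.Injective (ξ N).1 := by
    rw [injective_iff_map_eq_zero]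
    intro b hb
    have h0 : b ∈ ⨅ j, ⨅ _ : N ≤ j, (ξ j).1.ker := by
      simp only [AddSubgroup.mem_iInf, AddMonoidHom.mem_ker]
      exact fun j hj => by rw [hconst j hj, hb]
    rwa [hξ N, AddSubgroup.mem_bot] at h0
  have hcard := Fintype.card_le_of_injective _ hinj
  simp only [Fintype.card_fun, ZMod.card, Fintype.card_fin] at hcard
  have : 2 ^ 2 ≤ 2 ^ m := Nat.pow_le_pow_right (by norm_num) hm
  omega

end SchreierGraph

theorem mainTheorem5 (m : ℕ) (hm : 2 ≤ m) (ξ : ℕ → BinaryEpi m) (hξ : ξ ∈ spinalParameters m) :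
    (∃! η : ℕ → SpinalLetter m, IsSchreierWord ξ η) ∧
      (spinalSubshift ξ).Nonempty ∧
      IsSubshift (spinalSubshift ξ) ∧
      IsSimpleToeplitz (spinalSubshift ξ) (spinalEventualAlphabet ξ) ∧
      2 ≤ (spinalEventualAlphabet ξ).encard ∧
      IsAperiodic (spinalSubshift ξ) := by
  have hcard := two_le_encard_spinalEventualAlphabet hm hξ
  have hc := hcard
  rw [← eventualAlphabet_spinalLetters] at hc
  refine ⟨⟨_, (isSchreierWord_iff hξ).2 rfl, fun η hη => (isSchreierWord_iff hξ).1 hη⟩, ?_⟩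
  rw [spinalSubshift_eq hξ]
  refine ⟨wordSubshift_rulerWord_nonempty ?_, isSubshift_wordSubshift _, ?_, hcard,
    isAperiodic_rulerWord hc⟩
  · rw [← Set.encard_pos]
    exact lt_of_lt_of_le (by norm_num) hc
  · rw [← eventualAlphabet_spinalLetters]
    exact isSimpleToeplitz_rulerWord hc
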